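/- Let $k$ be an algebraically closed field of characteristic $0$, and call a family of forms $F_1,\dots,F_r\in k[x_1,\dots,x_n]$ a nonsingular system if the gradients $\nabla F_1(\mathbf{x}),\dots,\nabla F_r(\mathbf{x})$ are linearly independent for every non-zero $\mathbf{x}\in k^n$ with $F_1(\mathbf{x})=\dots=F_r(\mathbf{x})=0$. Let $Q_1,Q_2,Q_3\in k[x_1,\dots,x_n]$ be quadratic forms such that $\{Q_1,Q_2,Q_3\}$, $\{Q_1,Q_2\}$ and $\{Q_3\}$ are all nonsingular systems. Then for every integer $t$ with $3\le t\le (n-5)/2$ there is a $t$-dimensional projective linear subspace $L\subset\mathbb{P}^{n-1}$, contained in the quadric $Q_3=0$, such that $L\cap\{Q_1=Q_2=0\}$ is nonsingular, in the following sense: if $\ell_1,\dots,\ell_c$ is a minimal set of linear forms defining $L$, then $Q_1,Q_2,\ell_1,\dots,\ell_c$ is a nonsingular system. -/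

import Mathlib

/-- The gradient `∇F(x)` of a polynomial `F` in `n` variables at the point `x`. -/
noncomputable def gradAt {k : Type*} [CommRing k] {n : ℕ}
    (F : MvPolynomial (Fin n) k) (x : Fin n → k) : Fin n → k :=
  fun j => MvPolynomial.eval x (MvPolynomial.pderiv j F)

/-- A family of forms over an algebraically closed field `k` is a nonsingular system if the
gradients are linearly independent at every nonzero common zero in `k ^ n`. -/
def IsNonsingularSystem {k : Type*} [Field k] {n : ℕ} {ι : Type*}
    (F : ι → MvPolynomial (Fin n) k) : Prop :=
  ∀ x : Fin n → k, x ≠ 0 → (∀ i, MvPolynomial.eval x (F i) = 0) →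
    LinearIndependent k (fun i => gradAt (F i) x)

/-- `ℓ` is a minimal system of linear forms defining the linear space `L`. -/
structure IsMinimalEquations {k : Type*} [Field k] {n c : ℕ}
    (ℓ : Fin c → MvPolynomial (Fin n) k) (L : Submodule k (Fin n → k)) : Prop where
  linear : ∀ j, (ℓ j).IsHomogeneous 1
  independent : LinearIndependent k ℓ
  mem_iff : ∀ x, x ∈ L ↔ ∀ j, MvPolynomial.eval x (ℓ j) = 0

/-- `fano Q t` is the set of `t`-planes in projective `(n-1)`-space, i.e. of
`(t + 1)`-dimensional linear subspaces of `k ^ n`, which lie in the quadric `Q = 0`. -/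
def fano {k : Type*} [Field k] {n : ℕ} (Q : MvPolynomial (Fin n) k) (t : ℕ) :
    Set (Submodule k (Fin n → k)) :=
  {L | Module.finrank k L = t + 1 ∧ ∀ x ∈ L, MvPolynomial.eval x Q = 0}

/-- The section of `F₁ = F₂ = 0` by the linear space `L` is nonsingular: the forms `F₁`, `F₂`
together with a minimal set of linear forms defining `L` are a nonsingular system. Two minimal
sets differ by an invertible linear substitution, so the choice does not matter. -/
def IsNonsingularSection {k : Type*} [Field k] {n : ℕ}
    (L : Submodule k (Fin n → k)) (F₁ F₂ : MvPolynomial (Fin n) k) : Prop :=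
  ∃ (c : ℕ) (ℓ : Fin c → MvPolynomial (Fin n) k),
    IsMinimalEquations ℓ L ∧ IsNonsingularSystem (Sum.elim ![F₁, F₂] ℓ)

/-!
Let `S` be the Gram matrix of `Q`. Every `M` with `M + Mᵀ = 2 • S` gives an isometry `M⁻¹ * Mᵀ` of
`Q`, since `x ⬝ᵥ M *ᵥ x = x ⬝ᵥ Mᵀ *ᵥ x`. Translate one totally isotropic space, the column space of
`E`, by the isometry attached to `M = S + (Z - Zᵀ)` with `Z` generic. If for every such `Z` the
translate were tangent to `F = 0`, the witnesses of tangency would define one over the ultrapower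
of `k` along an ultrafilter containing all nonempty Zariski-open sets. There the entries of `Z` are
algebraically independent, so in characteristic zero the derivations `∂/∂Zᵢⱼ` extend to the
ultrapower. Differentiating the equation `M *ᵥ y = Mᵀ *ᵥ (E *ᵥ c)` of the point of tangency `y`
forces the normal vector `∑ aᵢ ∇Fᵢ(y)` to be proportional to `∇Q(y)`. The same then holds over `k`
for some `Z`, contradicting the nonsingularity of `F = Q = 0`.
-/

open MvPolynomial Matrix Filter
open scoped TensorProduct

/-! ### Derivations in characteristic zero -/

theorem exists_derivation_extending_of_formallyEtale {k R F : Type*} [CommRing k] [CommRing R]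
    [CommRing F] [Algebra k R] [Algebra k F] [Algebra R F] [IsScalarTower k R F]
    [Algebra.FormallyEtale R F] (D : Derivation k R F) :
    ∃ D' : Derivation k F F, ∀ r, D' (algebraMap R F r) = D r := by
  let φ : F ⊗[R] Ω[R⁄k] →ₗ[F] F := LinearMap.liftBaseChange F D.liftKaehlerDifferential
  let e := KaehlerDifferential.tensorKaehlerEquivOfFormallyEtale k R F
  refine ⟨(φ ∘ₗ e.symm.toLinearMap).compDer (KaehlerDifferential.D k F), fun r => ?_⟩
  simp [e, KaehlerDifferential.tensorKaehlerEquivOfFormallyEtale_symm_D_algebraMap, φ]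

theorem formallyEtale_of_isAlgebraic (R F : Type*) [CommRing R] [IsDomain R] [CharZero R]
    [Field F] [Algebra R F] [FaithfulSMul R F] [Algebra.IsAlgebraic R F] :
    Algebra.FormallyEtale R F := by
  let K := FractionRing R
  let _ : Algebra K F := FractionRing.liftAlgebra R F
  have : IsScalarTower R K F := FractionRing.isScalarTower_liftAlgebra R F
  have : Algebra.IsAlgebraic K F := IsFractionRing.comap_isAlgebraic_iff.1 ‹Algebra.IsAlgebraic R F›
  have : CharZero K := charZero_of_injective_algebraMap (IsFractionRing.injective R K)
  have : Algebra.FormallyEtale R K := .of_isLocalization (nonZeroDivisors R)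
  have : Algebra.FormallyEtale K F := .of_isSeparable K F
  exact .comp R K F

theorem exists_derivation_of_isTranscendenceBasis {k F ι : Type*} [Field k] [CharZero k] [Field F]
    [Algebra k F] {v : ι → F} (hv : IsTranscendenceBasis k v) (w : ι → F) :
    ∃ D : Derivation k F F, ∀ i, D (v i) = w i := by
  let _ : Algebra (MvPolynomial ι k) F := (aeval v).toAlgebra
  have : IsScalarTower k (MvPolynomial ι k) F := .of_algHom (aeval v)
  have : FaithfulSMul (MvPolynomial ι k) F := (faithfulSMul_iff_algebraMap_injective _ _).2 hv.1
  have : Algebra.IsAlgebraic (MvPolynomial ι k) F :=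
    have := hv.isAlgebraic
    .of_ringHom_of_comp_eq hv.1.aevalEquiv (RingHom.id F) hv.1.aevalEquiv.surjective
      Function.injective_id rfl
  have := formallyEtale_of_isAlgebraic (MvPolynomial ι k) F
  obtain ⟨D, hD⟩ := exists_derivation_extending_of_formallyEtale (mkDerivation k w)
  refine ⟨D, fun i => ?_⟩
  simpa [RingHom.algebraMap_toAlgebra] using hD (X i)

theorem exists_derivation_of_algebraicIndependent {k F ι : Type*} [Field k] [CharZero k] [Field F]
    [Algebra k F] {v : ι → F} (hv : AlgebraicIndependent k v) (w : ι → F) :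
    ∃ D : Derivation k F F, ∀ i, D (v i) = w i := by
  obtain ⟨t, hvt, ht⟩ := exists_isTranscendenceBasis_superset hv.coe_range
  let j : ι → t := fun i => ⟨v i, hvt ⟨i, rfl⟩⟩
  have hj : Function.Injective j := fun a b h => hv.injective (congrArg Subtype.val h)
  obtain ⟨D, hD⟩ := exists_derivation_of_isTranscendenceBasis ht (Function.extend j w 0)
  exact ⟨D, fun i => (hD (j i)).trans (hj.extend_apply w 0 i)⟩

theorem derivation_aeval {k A M σ : Type*} [CommRing k] [CommRing A] [Algebra k A]
    [AddCommGroup M] [Module A M] [Module k M] [Fintype σ]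
    (D : Derivation k A M) (y : σ → A) (f : MvPolynomial σ k) :
    D (aeval y f) = ∑ j, aeval y (pderiv j f) • D (y j) := by
  classical
  induction f using MvPolynomial.induction_on with
  | C a => simp
  | add p q hp hq => simp [hp, hq, add_smul, Finset.sum_add_distrib]
  | mul_X p i hp =>
    simp [hp, pderiv_X, Pi.single_apply, add_smul, Finset.sum_add_distrib, Finset.smul_sum,
      mul_smul, apply_ite (aeval y), ite_smul]

/-! ### Differentiating a tangency -/

section
variable {k F ι κ : Type*} [CommRing k] [CommRing F] [Algebra k F] (D : Derivation k F F)

theorem derivation_comp_mulVec [Fintype κ] (M : Matrix ι κ F) (v : κ → F) :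
    D ∘ (M *ᵥ v) = M.map D *ᵥ v + M *ᵥ (D ∘ v) := by
  ext i
  simp [mulVec, dotProduct, Finset.sum_add_distrib, mul_comm, add_comm]

theorem derivation_comp_map_algebraMap_mulVec [Fintype κ] (E : Matrix ι κ k) (v : κ → F) :
    D ∘ (E.map (algebraMap k F) *ᵥ v) = E.map (algebraMap k F) *ᵥ (D ∘ v) := by
  ext i
  simp [mulVec, dotProduct]
end

theorem exists_eq_smul_of_mul_eq_mul {F ι : Type*} [Field F] {z w : ι → F} (hw : w ≠ 0)
    (h : ∀ i j, z i * w j = z j * w i) : ∃ μ : F, z = μ • w := by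
  obtain ⟨j, hj⟩ := Function.ne_iff.1 hw
  refine ⟨z j / w j, funext fun i => ?_⟩
  rw [Pi.smul_apply, smul_eq_mul, div_mul_eq_mul_div, eq_div_iff hj, h i j]

theorem dotProduct_single_sub_single_mulVec {R ι : Type*} [CommRing R] [Fintype ι] [DecidableEq ι]
    (i j : ι) (z w : ι → R) :
    z ⬝ᵥ (single i j 1 - single j i 1) *ᵥ w = z i * w j - z j * w i := by
  simp [sub_mulVec, dotProduct_sub, single_mulVec_eq, mul_comm]

theorem vecMul_dotProduct_derivation {k F ι κ : Type*} [CommRing k] [CommRing F] [Algebra k F]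
    [Fintype ι] [Fintype κ] (D : Derivation k F F) {M : Matrix ι ι F} {E : Matrix ι κ k}
    {y z : ι → F} {c : κ → F} (hM : (M.map D)ᵀ = -M.map D)
    (hy : M *ᵥ y = Mᵀ *ᵥ (E.map (algebraMap k F) *ᵥ c))
    (hz : (M *ᵥ z) ᵥ* E.map (algebraMap k F) = 0) :
    (z ᵥ* M) ⬝ᵥ (D ∘ y) = -(z ⬝ᵥ M.map D *ᵥ (y + E.map (algebraMap k F) *ᵥ c)) := by
  set A := E.map (algebraMap k F) with hA
  have product_rule : M.map D *ᵥ y + M *ᵥ (D ∘ y) =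
      -(M.map D *ᵥ (A *ᵥ c)) + Mᵀ *ᵥ (A *ᵥ (D ∘ c)) := by
    rw [← derivation_comp_mulVec, hy, derivation_comp_mulVec, hA,
      derivation_comp_map_algebraMap_mulVec, transpose_map, hM, neg_mulVec]
  have orthogonal : z ⬝ᵥ Mᵀ *ᵥ (A *ᵥ (D ∘ c)) = 0 := by
    rw [dotProduct_mulVec, vecMul_transpose, dotProduct_mulVec, hz, zero_dotProduct]
  calc (z ᵥ* M) ⬝ᵥ (D ∘ y) = z ⬝ᵥ (M *ᵥ (D ∘ y)) := (dotProduct_mulVec _ _ _).symm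
    _ = z ⬝ᵥ (-(M.map D *ᵥ (A *ᵥ c)) + Mᵀ *ᵥ (A *ᵥ (D ∘ c)) - M.map D *ᵥ y) := by
      rw [← product_rule, add_sub_cancel_left]
    _ = _ := by
      rw [dotProduct_sub, dotProduct_add, orthogonal, dotProduct_neg, mulVec_add, dotProduct_add]
      ring

theorem exists_vecMul_eq_smul_mulVec {k F ι κ : Type*} [CommRing k] [Field F] [Algebra k F]
    [Fintype ι] [DecidableEq ι] [Fintype κ] {D : ι → ι → Derivation k F F} {M : Matrix ι ι F}
    {E : Matrix ι κ k} {y z : ι → F} {c : κ → F}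
    (hD : ∀ i j, M.map (D i j) = single i j 1 - single j i 1)
    (hy : M *ᵥ y = Mᵀ *ᵥ (E.map (algebraMap k F) *ᵥ c))
    (hz : (M *ᵥ z) ᵥ* E.map (algebraMap k F) = 0)
    (hzy : ∀ i j, (z ᵥ* M) ⬝ᵥ (D i j ∘ y) = 0) (hMy : (M + Mᵀ) *ᵥ y ≠ 0) :
    ∃ μ : F, z ᵥ* M = μ • (M + Mᵀ) *ᵥ y := by
  set w := y + E.map (algebraMap k F) *ᵥ c with hw
  have hMw : w ᵥ* M = (M + Mᵀ) *ᵥ y := by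
    rw [← mulVec_transpose, hw, mulVec_add, ← hy, add_mulVec, add_comm]
  have hw0 : w ≠ 0 := by
    intro h
    exact hMy (by rw [← hMw, h, zero_vecMul])
  obtain ⟨μ, hμ⟩ := exists_eq_smul_of_mul_eq_mul (z := z) hw0 fun i j => by
    have h := vecMul_dotProduct_derivation (D i j) (by simp [hD]) hy hz
    rw [hzy, hD, ← hw, dotProduct_single_sub_single_mulVec] at h
    linear_combination h
  exact ⟨μ, by rw [hμ, smul_vecMul, hMw]⟩

/-- The Jacobian matrix of the family `F` at a point `y` with coordinates in a `k`-algebra `A`, so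
that the same notion serves `k` and its ultrapower. Its rows are the gradients of the `F i`. -/
noncomputable def jacobianAt {k A σ ι : Type*} [CommRing k] [CommRing A] [Algebra k A]
    (F : ι → MvPolynomial σ k) (y : σ → A) : Matrix ι σ A :=
  of fun i j => aeval y (pderiv j (F i))

theorem derivation_comp_aeval {k A σ ι : Type*} [CommRing k] [CommRing A] [Algebra k A] [Fintype σ]
    (D : Derivation k A A) (F : ι → MvPolynomial σ k) (y : σ → A) :
    (D ∘ fun i => aeval y (F i)) = jacobianAt F y *ᵥ (D ∘ y) :=
  funext fun i => derivation_aeval D y (F i)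

theorem aeval_algHom_comp {k A B σ : Type*} [CommRing k] [CommRing A] [Algebra k A] [CommRing B]
    [Algebra k B] (f : A →ₐ[k] B) (y : σ → A) (p : MvPolynomial σ k) :
    aeval (f ∘ y) p = f (aeval y p) :=
  (comp_aeval_apply y f p).symm

theorem jacobianAt_comp {k A B σ ι : Type*} [CommRing k] [CommRing A] [Algebra k A] [CommRing B]
    [Algebra k B] (f : A →ₐ[k] B) (F : ι → MvPolynomial σ k) (y : σ → A) :
    jacobianAt F (f ∘ y) = (jacobianAt F y).map f := by
  ext i j
  exact aeval_algHom_comp f y (pderiv j (F i))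

/-- Witness of a tangency between `F = 0` and the translate by `M⁻¹ * Mᵀ` of the column space
of `E`: the common zero `y` of `F` is the translate of `E *ᵥ c`, and the combination of gradients
with coefficients `a` is orthogonal to the translate. The orthogonality is expressed through
`z`, the row vector with `z ᵥ* M` equal to that combination, so that no inverse occurs. -/
structure IsTangency {k A σ ι κ : Type*} [CommRing k] [CommRing A] [Algebra k A] [Fintype σ]
    [Fintype ι] [Fintype κ] (F : ι → MvPolynomial σ k) (E : Matrix σ κ k) (M : Matrix σ σ A)
    (c : κ → A) (y z : σ → A) (a : ι → A) : Prop where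
  translate : M *ᵥ y = Mᵀ *ᵥ (E.map (algebraMap k A) *ᵥ c)
  zero : ∀ i, aeval y (F i) = 0
  gradient : z ᵥ* M = a ᵥ* jacobianAt F y
  tangent : (M *ᵥ z) ᵥ* E.map (algebraMap k A) = 0

namespace IsTangency

variable {k A B σ ι κ Ω : Type*} [Fintype σ] [Fintype ι] [Fintype κ]

theorem exists_gradient_eq_smul [DecidableEq σ] [CommRing k] [Field A] [Algebra k A]
    {F : ι → MvPolynomial σ k} {E : Matrix σ κ k} {M : Matrix σ σ A}
    {c : κ → A} {y z : σ → A} {a : ι → A} (h : IsTangency F E M c y z a)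
    {D : σ → σ → Derivation k A A} (hD : ∀ i j, M.map (D i j) = single i j 1 - single j i 1)
    (hMy : (M + Mᵀ) *ᵥ y ≠ 0) :
    ∃ μ : A, a ᵥ* jacobianAt F y = μ • (M + Mᵀ) *ᵥ y := by
  rw [← h.gradient]
  refine exists_vecMul_eq_smul_mulVec hD h.translate h.tangent (fun i j => ?_) hMy
  rw [h.gradient, ← dotProduct_mulVec, ← derivation_comp_aeval, funext h.zero]
  simp [dotProduct]

theorem of_eventually [CommRing k] [CommRing A] [CommRing B] [Algebra k A] [Algebra k B]
    {l : Filter Ω} {f : A →ₐ[k] B} {g : Ω → A →ₐ[k] k}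
    (hfg : ∀ x y, (∀ᶠ ω in l, g ω x = g ω y) → f x = f y)
    {F : ι → MvPolynomial σ k} {E : Matrix σ κ k} {M : Matrix σ σ A}
    {c : κ → A} {y z : σ → A} {a : ι → A}
    (h : ∀ᶠ ω in l, IsTangency F E (M.map (g ω)) (g ω ∘ c) (g ω ∘ y) (g ω ∘ z) (g ω ∘ a)) :
    IsTangency F E (M.map f) (f ∘ c) (f ∘ y) (f ∘ z) (f ∘ a) := by
  constructor
  · ext i
    simpa [mulVec, dotProduct] using hfg ((M *ᵥ y) i) ((Mᵀ *ᵥ (E.map (algebraMap k A) *ᵥ c)) i)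
      (h.mono fun ω hω => by simpa [mulVec, dotProduct] using congrFun hω.translate i)
  · intro i
    simpa only [aeval_algHom_comp, map_zero] using hfg (aeval y (F i)) 0
      (h.mono fun ω hω => by simpa only [aeval_algHom_comp, map_zero] using hω.zero i)
  · ext j
    simpa [jacobianAt_comp, vecMul, dotProduct] using hfg ((z ᵥ* M) j) ((a ᵥ* jacobianAt F y) j)
      (h.mono fun ω hω => by
        simpa [jacobianAt_comp, vecMul, dotProduct] using congrFun hω.gradient j)
  · ext j
    simpa [mulVec, vecMul, dotProduct] using hfg (((M *ᵥ z) ᵥ* E.map (algebraMap k A)) j) 0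
      (h.mono fun ω hω => by simpa [mulVec, vecMul, dotProduct] using congrFun hω.tangent j)

end IsTangency

/-! ### The ultrapower at a generic point -/

/-- The filter `l` on affine space contains every nonempty Zariski-open set: the notion of a
generic point used here. -/
def IsZariskiGeneric {σ k : Type*} [CommRing k] (l : Filter (σ → k)) : Prop :=
  ∀ P : MvPolynomial σ k, P ≠ 0 → ∀ᶠ x in l, eval x P ≠ 0

theorem exists_ultrafilter_isZariskiGeneric (σ k : Type*) [CommRing k] [IsDomain k] [Infinite k] :
    ∃ U : Ultrafilter (σ → k), IsZariskiGeneric (U : Filter (σ → k)) := by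
  let l : Filter (σ → k) := ⨅ P : {P : MvPolynomial σ k // P ≠ 0}, 𝓟 {x | eval x P.1 ≠ 0}
  have : l.NeBot := by
    refine iInf_neBot_of_directed (fun P R => ⟨⟨P * R, mul_ne_zero P.2 R.2⟩, ?_, ?_⟩) fun P => ?_
    · exact principal_mono.2 fun x hx => left_ne_zero_of_mul (by simpa using hx)
    · exact principal_mono.2 fun x hx => right_ne_zero_of_mul (by simpa using hx)
    · refine principal_neBot_iff.2 ?_
      by_contra! h
      refine P.2 (MvPolynomial.funext fun x => ?_)
      simpa using Set.eq_empty_iff_forall_notMem.1 h x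
  obtain ⟨U, hU⟩ := Ultrafilter.exists_le l
  exact ⟨U, fun P hP => hU (mem_iInf_of_mem ⟨P, hP⟩ (mem_principal_self _))⟩

-- Working with `K` and `f` abstractly keeps elaboration from unfolding `Germ`.
theorem exists_ultrapower.{u, v} (k : Type u) {Ω : Type v} [Field k] (U : Ultrafilter Ω) :
    ∃ (K : Type (max u v)) (_ : Field K) (_ : Algebra k K) (f : (Ω → k) →ₐ[k] K),
      Function.Surjective f ∧ ∀ u v, f u = f v ↔ ∀ᶠ x in (U : Filter Ω), u x = v x := by
  let f := Germ.coeRingHom (R := k) (U : Filter Ω)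
  let _ : Algebra k (Germ (U : Filter Ω) k) := (f.comp (algebraMap k (Ω → k))).toAlgebra
  exact ⟨Germ (U : Filter Ω) k, inferInstance, inferInstance, { f with commutes' := fun _ => rfl },
    Quot.exists_rep, fun _ _ => Germ.coe_eq⟩

/-- The matrix `S + (Z - Zᵀ)`, where `Z` has entries `z`. As `z` varies, these are all the matrices
with the same symmetric part as `S`. -/
noncomputable def skewShift {k A σ : Type*} [CommRing k] [CommRing A] [Algebra k A]
    (S : Matrix σ σ k) (z : σ × σ → A) : Matrix σ σ A :=
  S.map (algebraMap k A) + of fun i j => z (i, j) - z (j, i)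

section
variable {k A B σ : Type*} [CommRing k] [CommRing A] [Algebra k A] [CommRing B] [Algebra k B]
  (S : Matrix σ σ k)

theorem skewShift_map (f : A →ₐ[k] B) (z : σ × σ → A) :
    (skewShift S z).map f = skewShift S (f ∘ z) := by
  ext
  simp [skewShift]

theorem skewShift_map_derivation (D : Derivation k A A) (z : σ × σ → A) :
    (skewShift S z).map D = of fun i j => D (z (i, j)) - D (z (j, i)) := by
  ext
  simp [skewShift]

variable {S} in
theorem skewShift_add_transpose (hS : Sᵀ = S) (z : σ × σ → k) :
    skewShift S z + (skewShift S z)ᵀ = (2 : k) • S := by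
  ext i j
  have : S j i = S i j := congrFun₂ hS i j
  simp only [skewShift, Algebra.algebraMap_self, RingHom.coe_id, Matrix.map_id, transpose_add,
    Matrix.add_apply, of_apply, transpose_apply, this, Matrix.smul_apply, smul_eq_mul]
  ring

variable {S} in
theorem det_skewShift_X_ne_zero [Fintype σ] [DecidableEq σ] (hS : S.det ≠ 0) :
    (skewShift S (X : σ × σ → MvPolynomial (σ × σ) k)).det ≠ 0 := by
  intro h
  have := congrArg (aeval (0 : σ × σ → k)) h
  rw [AlgHom.map_det, AlgHom.mapMatrix_apply, skewShift_map, map_zero] at this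
  apply hS
  convert this
  ext
  simp [skewShift]
end

section
variable {k σ Ω K : Type*} [Field k] [Field K] [Algebra k K]

theorem aeval_coord (P : MvPolynomial σ k) :
    aeval (fun i (x : σ → k) => x i) P = fun x => eval x P := by
  ext x
  exact (aeval_algHom_comp (Pi.evalAlgHom k (fun _ : σ → k => k) x) (fun i x => x i) P).symm

theorem algebraicIndependent_ultrapower {U : Ultrafilter (σ → k)} {f : ((σ → k) → k) →ₐ[k] K}
    (hf : ∀ u v, f u = f v ↔ ∀ᶠ x in (U : Filter (σ → k)), u x = v x)
    (hU : IsZariskiGeneric (U : Filter (σ → k))) :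
    AlgebraicIndependent k (f ∘ fun i x => x i) := by
  refine (injective_iff_map_eq_zero _).2 fun P hP => ?_
  rw [aeval_algHom_comp, aeval_coord, ← map_zero f, hf] at hP
  by_contra h
  obtain ⟨x, hx, hx'⟩ := ((hU P h).and hP).exists
  exact hx hx'

theorem algHom_comp_eq_iff {ι : Type*} [Finite ι] {l : Filter Ω} {f : (Ω → k) →ₐ[k] K}
    (hf : ∀ u v, f u = f v ↔ ∀ᶠ x in l, u x = v x) {u v : ι → Ω → k} :
    f ∘ u = f ∘ v ↔ ∀ᶠ x in l, (u · x) = (v · x) := by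
  simp [funext_iff, hf]

theorem algHom_comp_ne_zero {ι : Type*} [Finite ι] {l : Filter Ω} [l.NeBot] {f : (Ω → k) →ₐ[k] K}
    (hf : ∀ u v, f u = f v ↔ ∀ᶠ x in l, u x = v x) {u : ι → Ω → k}
    (hu : ∀ᶠ x in l, (u · x) ≠ 0) : f ∘ u ≠ 0 := by
  intro h
  have : f ∘ u = f ∘ (0 : ι → Ω → k) := h.trans (funext fun _ => (map_zero f).symm)
  obtain ⟨x, hx, hx'⟩ := (hu.and ((algHom_comp_eq_iff hf).1 this)).exists
  exact hx hx'

end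

theorem skewShift_map_eq_single_sub_single {k A σ : Type*} [CommRing k] [CommRing A] [Algebra k A]
    [DecidableEq σ] {S : Matrix σ σ k} {D : Derivation k A A} {z : σ × σ → A} {i j : σ}
    (hD : ∀ p, D (z p) = (Pi.single (i, j) 1 : σ × σ → A) p) :
    (skewShift S z).map D = single i j 1 - single j i 1 := by
  rw [skewShift_map_derivation]
  ext
  simp [hD, Pi.single_apply, single_apply, eq_comm, and_comm]

theorem algHom_comp_add_transpose_mulVec {k A B σ : Type*} [CommRing k] [CommRing A] [Algebra k A]
    [CommRing B] [Algebra k B] [Fintype σ] (f : A →ₐ[k] B) (M : Matrix σ σ A) (y : σ → A) :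
    f ∘ ((M + Mᵀ) *ᵥ y) = (M.map f + (M.map f)ᵀ) *ᵥ (f ∘ y) := by
  ext
  simp [mulVec, dotProduct]

theorem algHom_comp_vecMul_jacobianAt {k A B σ ι : Type*} [CommRing k] [CommRing A] [Algebra k A]
    [CommRing B] [Algebra k B] [Fintype ι] (f : A →ₐ[k] B) (F : ι → MvPolynomial σ k) (a : ι → A)
    (y : σ → A) :
    f ∘ (a ᵥ* jacobianAt F y) = (f ∘ a) ᵥ* jacobianAt F (f ∘ y) := by
  ext
  simp [jacobianAt_comp, vecMul, dotProduct]

theorem eventually_exists_gradient_eq_smul {k σ ι κ : Type*} [Field k] [CharZero k] [Fintype σ]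
    [Fintype ι] [Fintype κ] {U : Ultrafilter (σ × σ → k)}
    (hU : IsZariskiGeneric (U : Filter (σ × σ → k)))
    {F : ι → MvPolynomial σ k} {E : Matrix σ κ k} {S : Matrix σ σ k}
    {c : κ → (σ × σ → k) → k} {y z : σ → (σ × σ → k) → k} {a : ι → (σ × σ → k) → k}
    (h : ∀ᶠ x in (U : Filter (σ × σ → k)),
      IsTangency F E (skewShift S x) (c · x) (y · x) (z · x) (a · x))
    (hy : ∀ᶠ x in (U : Filter (σ × σ → k)), (skewShift S x + (skewShift S x)ᵀ) *ᵥ (y · x) ≠ 0) :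
    ∀ᶠ x in (U : Filter (σ × σ → k)), ∃ μ : k,
      (a · x) ᵥ* jacobianAt F (y · x) = μ • (skewShift S x + (skewShift S x)ᵀ) *ᵥ (y · x) := by
  classical
  obtain ⟨K, _, _, f, f_surjective, hf⟩ := exists_ultrapower k U
  let M : Matrix σ σ ((σ × σ → k) → k) := skewShift S fun p x => x p
  let ev (x : σ × σ → k) : ((σ × σ → k) → k) →ₐ[k] k := Pi.evalAlgHom k _ x
  have hM (x) : M.map (ev x) = skewShift S x := skewShift_map S _ _
  have tangency : IsTangency F E (M.map f) (f ∘ c) (f ∘ y) (f ∘ z) (f ∘ a) :=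
    .of_eventually (g := ev) (fun u v => (hf u v).2) (h.mono fun x hx => by rwa [hM])
  choose D hD using fun p => exists_derivation_of_algebraicIndependent
    (algebraicIndependent_ultrapower hf hU) (Pi.single p 1)
  have map_M_derivation (i j) : (M.map f).map (D (i, j)) = single i j 1 - single j i 1 := by
    rw [skewShift_map]
    exact skewShift_map_eq_single_sub_single (hD _)
  have apply_add_mulVec (x) : (((M + Mᵀ) *ᵥ y) · x) =
      (skewShift S x + (skewShift S x)ᵀ) *ᵥ (y · x) := by
    rw [← hM]
    exact algHom_comp_add_transpose_mulVec (ev x) M y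
  have ne_zero : (M.map f + (M.map f)ᵀ) *ᵥ (f ∘ y) ≠ 0 := by
    rw [← algHom_comp_add_transpose_mulVec]
    exact algHom_comp_ne_zero hf (hy.mono fun x hx => by rwa [apply_add_mulVec])
  obtain ⟨μ, hμ⟩ := tangency.exists_gradient_eq_smul (D := fun i j => D (i, j)) map_M_derivation
    ne_zero
  obtain ⟨m, rfl⟩ := f_surjective μ
  have hm : f ∘ (a ᵥ* jacobianAt F y) = f ∘ (m • (M + Mᵀ) *ᵥ y) := by
    rw [algHom_comp_vecMul_jacobianAt, hμ, ← algHom_comp_add_transpose_mulVec]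
    ext
    simp
  refine ((algHom_comp_eq_iff hf).1 hm).mono fun x hx => ⟨m x, ?_⟩
  rw [← apply_add_mulVec]
  exact (algHom_comp_vecMul_jacobianAt (ev x) F a y).symm.trans hx

/-! ### Transversal translates -/

theorem dotProduct_transpose_mulVec_self {R σ : Type*} [CommRing R] [Fintype σ] (M : Matrix σ σ R)
    (x : σ → R) : x ⬝ᵥ Mᵀ *ᵥ x = x ⬝ᵥ M *ᵥ x := by
  rw [dotProduct_mulVec, vecMul_transpose, dotProduct_comm]

theorem dotProduct_mulVec_self_eq_of_mulVec_eq {R σ : Type*} [CommRing R] [Fintype σ]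
    {M : Matrix σ σ R} {x y : σ → R} (h : M *ᵥ y = Mᵀ *ᵥ x) :
    y ⬝ᵥ M *ᵥ y = x ⬝ᵥ M *ᵥ x := by
  calc y ⬝ᵥ M *ᵥ y = y ⬝ᵥ Mᵀ *ᵥ x := by rw [h]
    _ = (M *ᵥ y) ⬝ᵥ x := by rw [dotProduct_mulVec, vecMul_transpose]
    _ = x ⬝ᵥ Mᵀ *ᵥ x := by rw [h, dotProduct_comm]
    _ = x ⬝ᵥ M *ᵥ x := dotProduct_transpose_mulVec_self M x

theorem dotProduct_mulVec_self_of_add_transpose_eq {k σ : Type*} [Field k] [CharZero k] [Fintype σ]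
    {M S : Matrix σ σ k} (hM : M + Mᵀ = (2 : k) • S) (x : σ → k) :
    x ⬝ᵥ S *ᵥ x = x ⬝ᵥ M *ᵥ x := by
  have h : x ⬝ᵥ (M + Mᵀ) *ᵥ x = x ⬝ᵥ ((2 : k) • S) *ᵥ x := by rw [hM]
  rw [add_mulVec, dotProduct_add, dotProduct_transpose_mulVec_self, smul_mulVec, dotProduct_smul,
    smul_eq_mul, ← two_mul] at h
  exact (mul_left_cancel₀ two_ne_zero h).symm

theorem dotProduct_mulVec_eq_of_mulVec_eq {k σ : Type*} [Field k] [CharZero k] [Fintype σ]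
    {M S : Matrix σ σ k} (hM : M + Mᵀ = (2 : k) • S) {x y : σ → k} (h : M *ᵥ y = Mᵀ *ᵥ x) :
    y ⬝ᵥ S *ᵥ y = x ⬝ᵥ S *ᵥ x := by
  simp only [dotProduct_mulVec_self_of_add_transpose_eq hM,
    dotProduct_mulVec_self_eq_of_mulVec_eq h]

theorem exists_forall_isTangency_eq_zero {k σ ι κ : Type*} [Field k] [CharZero k] [Fintype σ]
    [DecidableEq σ] [Fintype ι] [Fintype κ] {S : Matrix σ σ k} (hS : Sᵀ = S) (hdet : S.det ≠ 0)
    {E : Matrix σ κ k} (hE : ∀ c, (E *ᵥ c) ⬝ᵥ S *ᵥ (E *ᵥ c) = 0) {F : ι → MvPolynomial σ k}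
    (hF : ∀ y ≠ 0, (∀ i, aeval y (F i) = 0) → y ⬝ᵥ S *ᵥ y = 0 →
      ∀ a (μ : k), a ᵥ* jacobianAt F y = μ • S *ᵥ y → a = 0) :
    ∃ M : Matrix σ σ k, M + Mᵀ = (2 : k) • S ∧ M.det ≠ 0 ∧
      ∀ c y z a, IsTangency F E M c y z a → y ≠ 0 → a = 0 := by
  obtain ⟨U, hU⟩ := exists_ultrafilter_isZariskiGeneric (σ × σ) k
  have det_ne_zero : ∀ᶠ x in (U : Filter (σ × σ → k)), (skewShift S x).det ≠ 0 := by
    refine (hU _ (det_skewShift_X_ne_zero hdet)).mono fun x hx => ?_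
    rw [← coe_aeval_eq_eval, RingHom.coe_coe, AlgHom.map_det, AlgHom.mapMatrix_apply,
      skewShift_map] at hx
    simpa [Function.comp_def] using hx
  by_contra! H
  have tangency : ∀ᶠ x in (U : Filter (σ × σ → k)), ∃ p : (κ → k) × (σ → k) × (σ → k) × (ι → k),
      IsTangency F E (skewShift S x) p.1 p.2.1 p.2.2.1 p.2.2.2 ∧ p.2.1 ≠ 0 ∧ p.2.2.2 ≠ 0 :=
    det_ne_zero.mono fun x hx => by
      obtain ⟨c, y, z, a, h, hy, ha⟩ := H _ (skewShift_add_transpose hS x) hx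
      exact ⟨(c, y, z, a), h, hy, ha⟩
  obtain ⟨p, hp⟩ := tangency.choice
  have gradient := eventually_exists_gradient_eq_smul hU (c := fun i x => (p x).1 i)
    (y := fun i x => (p x).2.1 i) (z := fun i x => (p x).2.2.1 i) (a := fun i x => (p x).2.2.2 i)
    (hp.mono fun x hx => hx.1) (hp.mono fun x hx => by
      rw [skewShift_add_transpose hS, smul_mulVec]
      exact smul_ne_zero two_ne_zero fun h => hx.2.1 (eq_zero_of_mulVec_eq_zero hdet h))
  obtain ⟨x, ⟨h, hy, ha⟩, μ, hμ⟩ := (hp.and gradient).exists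
  rw [skewShift_add_transpose hS, smul_mulVec, smul_smul] at hμ
  refine ha (hF _ hy h.zero ?_ _ _ hμ)
  rw [dotProduct_mulVec_eq_of_mulVec_eq (skewShift_add_transpose hS x) h.translate]
  exact hE _

section
variable {k σ ι κ : Type*} [Field k] [Fintype σ] [DecidableEq σ] [Fintype ι] [Fintype κ]

/-- The translate of the column space of `E` by `M⁻¹ * Mᵀ`, an isometry of the quadratic form
`x ⬝ᵥ M *ᵥ x`. -/
noncomputable def cayleyTranslate (M : Matrix σ σ k) (E : Matrix σ κ k) : Submodule k (σ → k) :=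
  LinearMap.range (M⁻¹ * Mᵀ * E).mulVecLin

variable {M : Matrix σ σ k} {E : Matrix σ κ k}

theorem mem_cayleyTranslate_iff (hM : M.det ≠ 0) {u : σ → k} :
    u ∈ cayleyTranslate M E ↔ ∃ c, M *ᵥ u = Mᵀ *ᵥ (E *ᵥ c) := by
  have : Invertible M := M.invertibleOfIsUnitDet hM.isUnit
  simp only [cayleyTranslate, LinearMap.mem_range, mulVecLin_apply, ← mulVec_mulVec]
  exact exists_congr fun c =>
    ⟨by rintro rfl; simp, fun h => by rw [← h]; simp⟩

theorem finrank_cayleyTranslate (hM : M.det ≠ 0) (hE : Function.Injective E.mulVec) :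
    Module.finrank k (cayleyTranslate M E) = Fintype.card κ := by
  have hMT : IsUnit Mᵀ := (isUnit_iff_isUnit_det _).2 (by simpa using hM)
  have hM' : IsUnit M⁻¹ := by simpa [isUnit_iff_isUnit_det] using hM
  rw [cayleyTranslate, LinearMap.finrank_range_of_inj, Module.finrank_fintype_fun_eq_card]
  intro c c' h
  simp only [mulVecLin_apply, ← mulVec_mulVec] at h
  exact hE (mulVec_injective_of_isUnit hMT (mulVec_injective_of_isUnit hM' h))

theorem IsTangency.exists_of_orthogonal (hM : M.det ≠ 0) {F : ι → MvPolynomial σ k}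
    {c : κ → k} {y : σ → k} {a : ι → k} (hy : M *ᵥ y = Mᵀ *ᵥ (E *ᵥ c))
    (hF : ∀ i, aeval y (F i) = 0)
    (ha : ∀ u ∈ cayleyTranslate M E, (a ᵥ* jacobianAt F y) ⬝ᵥ u = 0) :
    ∃ z, IsTangency F E M c y z a := by
  have gradient : ((a ᵥ* jacobianAt F y) ᵥ* M⁻¹) ᵥ* M = a ᵥ* jacobianAt F y := by
    rw [vecMul_vecMul, nonsing_inv_mul _ hM.isUnit, vecMul_one]
  set z := (a ᵥ* jacobianAt F y) ᵥ* M⁻¹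
  refine ⟨z, hy, hF, gradient, dotProduct_eq_zero_iff.1 fun b => ?_⟩
  obtain ⟨u, hu⟩ := mulVec_surjective_iff_isUnit.2 ((isUnit_iff_isUnit_det M).2 hM.isUnit)
    (Mᵀ *ᵥ (E *ᵥ b))
  calc ((M *ᵥ z) ᵥ* E) ⬝ᵥ b = z ⬝ᵥ Mᵀ *ᵥ (E *ᵥ b) := by
        rw [← dotProduct_mulVec, dotProduct_mulVec z, vecMul_transpose]
    _ = (z ᵥ* M) ⬝ᵥ u := by rw [← hu, dotProduct_mulVec]
    _ = 0 := by rw [gradient, ha u ((mem_cayleyTranslate_iff hM).2 ⟨b, hu⟩)]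
end

/-! ### Isotropic subspaces -/

theorem exists_mul_sq_add_mul_sq_eq_zero {k : Type*} [Field k] [IsAlgClosed k] (a b : k) :
    ∃ x y : k, (x ≠ 0 ∨ y ≠ 0) ∧ a * x ^ 2 + b * y ^ 2 = 0 := by
  by_cases hb : b = 0
  · exact ⟨0, 1, .inr one_ne_zero, by simp [hb]⟩
  · obtain ⟨y, hy⟩ := IsAlgClosed.exists_pow_nat_eq (-a / b) two_pos
    exact ⟨1, y, .inl one_ne_zero, by rw [hy]; field_simp; ring⟩

theorem exists_injective_weightedSumSquares_sum_eq_zero {k κ : Type*} [Field k] [IsAlgClosed k]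
    [Fintype κ] (w : κ ⊕ κ → k) :
    ∃ φ : (κ → k) →ₗ[k] (κ ⊕ κ → k), Function.Injective φ ∧
      ∀ c, QuadraticMap.weightedSumSquares k w (φ c) = 0 := by
  choose x y hxy hw using fun j => exists_mul_sq_add_mul_sq_eq_zero (w (.inl j)) (w (.inr j))
  refine ⟨{ toFun c := Sum.elim (c * x) (c * y)
            map_add' c c' := by ext (j | j) <;> simp [add_mul]
            map_smul' r c := by ext (j | j) <;> simp }, ?_, fun c => ?_⟩
  · refine (injective_iff_map_eq_zero _).2 fun c hc => funext fun j => ?_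
    have hx : c j * x j = 0 := congrFun hc (.inl j)
    have hy : c j * y j = 0 := congrFun hc (.inr j)
    rcases hxy j with hj | hj
    · exact (mul_eq_zero.1 hx).resolve_right hj
    · exact (mul_eq_zero.1 hy).resolve_right hj
  · simp only [QuadraticMap.weightedSumSquares_apply, smul_eq_mul, LinearMap.coe_mk, AddHom.coe_mk,
      Fintype.sum_sum_type, Sum.elim_inl, Sum.elim_inr, Pi.mul_apply, ← Finset.sum_add_distrib]
    exact Finset.sum_eq_zero fun j _ => by linear_combination c j ^ 2 * hw j

theorem weightedSumSquares_extendByZero {k σ κ : Type*} [CommRing k] [Fintype σ] [Fintype κ]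
    (w : σ → k) (e : κ ↪ σ) (v : κ → k) :
    QuadraticMap.weightedSumSquares k w (Function.ExtendByZero.linearMap k e v) =
      QuadraticMap.weightedSumSquares k (w ∘ e) v := by
  simp only [QuadraticMap.weightedSumSquares_apply, Function.ExtendByZero.linearMap_apply]
  refine (Fintype.sum_of_injective e e.injective _ _ (fun i hi => ?_) fun p => ?_).symm
  · rw [Function.extend_apply' _ _ _ hi, Pi.zero_apply, mul_zero, smul_zero]
  · rw [e.injective.extend_apply, Function.comp_apply]

theorem exists_injective_weightedSumSquares_eq_zero {k σ : Type*} [Field k] [IsAlgClosed k]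
    [Fintype σ] (w : σ → k) {m : ℕ} (hm : 2 * m ≤ Fintype.card σ) :
    ∃ φ : (Fin m → k) →ₗ[k] (σ → k), Function.Injective φ ∧
      ∀ c, QuadraticMap.weightedSumSquares k w (φ c) = 0 := by
  obtain ⟨e⟩ : Nonempty (Fin m ⊕ Fin m ↪ σ) :=
    Function.Embedding.nonempty_of_card_le (by simpa [← two_mul] using hm)
  obtain ⟨φ, φ_injective, hφ⟩ := exists_injective_weightedSumSquares_sum_eq_zero (w ∘ e)
  refine ⟨Function.ExtendByZero.linearMap k e ∘ₗ φ, ?_, fun c => ?_⟩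
  · exact (Function.extend_injective e.injective (0 : σ → k)).comp φ_injective
  · rw [LinearMap.comp_apply, weightedSumSquares_extendByZero, hφ]

theorem exists_injective_quadraticForm_eq_zero {k V : Type*} [Field k] [IsAlgClosed k] [CharZero k]
    [AddCommGroup V] [Module k V] [FiniteDimensional k V] (Q : QuadraticForm k V) {m : ℕ}
    (hm : 2 * m ≤ Module.finrank k V) :
    ∃ φ : (Fin m → k) →ₗ[k] V, Function.Injective φ ∧ ∀ c, Q (φ c) = 0 := by
  have : Invertible (2 : k) := invertibleOfNonzero two_ne_zero
  obtain ⟨w, ⟨e⟩⟩ := Q.equivalent_weightedSumSquares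
  obtain ⟨φ, φ_injective, hφ⟩ := exists_injective_weightedSumSquares_eq_zero w (m := m) (by simpa)
  refine ⟨e.symm.toLinearEquiv ∘ₗ φ, e.symm.toLinearEquiv.injective.comp φ_injective, fun c => ?_⟩
  exact (e.symm.map_app (φ c)).trans (hφ c)

theorem exists_injective_dotProduct_mulVec_eq_zero {k σ : Type*} [Field k] [IsAlgClosed k]
    [CharZero k] [Fintype σ] (S : Matrix σ σ k) {m : ℕ} (hm : 2 * m ≤ Fintype.card σ) :
    ∃ E : Matrix σ (Fin m) k, Function.Injective E.mulVec ∧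
      ∀ c, (E *ᵥ c) ⬝ᵥ S *ᵥ (E *ᵥ c) = 0 := by
  classical
  obtain ⟨φ, φ_injective, hφ⟩ := exists_injective_quadraticForm_eq_zero S.toQuadraticForm'
    (m := m) (by simpa)
  have mulVec_eq (c) : LinearMap.toMatrix' φ *ᵥ c = φ c := LinearMap.toMatrix'_mulVec φ c
  refine ⟨LinearMap.toMatrix' φ, fun c c' h => φ_injective ?_, fun c => ?_⟩
  · rw [← mulVec_eq, ← mulVec_eq, h]
  · rw [mulVec_eq, ← hφ c]
    exact (Matrix.toLinearMap₂'_apply' S (φ c) (φ c)).symm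

/-! ### Nonsingular systems and linear sections -/

theorem pderiv_comm {k σ : Type*} [CommRing k] (i j : σ) (P : MvPolynomial σ k) :
    pderiv i (pderiv j P) = pderiv j (pderiv i P) := by
  ext
  simp only [coeff_pderiv]
  by_cases h : i = j
  · rw [h]
  · simp only [Finsupp.coe_add, Pi.add_apply, ne_eq, Ne.symm h, not_false_eq_true,
      Finsupp.single_eq_of_ne, add_zero, h]
    grind

section
variable {k : Type*} [CommRing k] {n d : ℕ} {P : MvPolynomial (Fin n) k}

theorem gradAt_dotProduct_self (hP : P.IsHomogeneous d) (x : Fin n → k) :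
    gradAt P x ⬝ᵥ x = d * eval x P := by
  simpa [gradAt, dotProduct, mul_comm] using congrArg (eval x) hP.sum_X_mul_pderiv

theorem gradAt_eq_of_isHomogeneous_one (hP : P.IsHomogeneous 1) (x y : Fin n → k) :
    gradAt P x = gradAt P y := by
  ext i
  have h : (pderiv i P).totalDegree = 0 := Nat.le_zero.1 hP.pderiv.totalDegree_le
  rw [gradAt, gradAt, totalDegree_eq_zero_iff_eq_C.1 h, eval_C, eval_C]

theorem gradAt_dotProduct_of_isHomogeneous_one (hP : P.IsHomogeneous 1) (x y : Fin n → k) :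
    gradAt P x ⬝ᵥ y = eval y P := by
  rw [gradAt_eq_of_isHomogeneous_one hP x y, gradAt_dotProduct_self hP, Nat.cast_one, one_mul]

end

theorem exists_symmetric_gradAt_eq_mulVec {k : Type*} [Field k] [CharZero k] {n : ℕ}
    {Q : MvPolynomial (Fin n) k} (hQ : Q.IsHomogeneous 2) :
    ∃ S : Matrix (Fin n) (Fin n) k, Sᵀ = S ∧ (∀ x, eval x Q = x ⬝ᵥ S *ᵥ x) ∧
      ∀ x, gradAt Q x = (2 : k) • S *ᵥ x := by
  let S : Matrix (Fin n) (Fin n) k := (2⁻¹ : k) • of fun i => gradAt (pderiv i Q) 0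
  have gradient (x) : gradAt Q x = (2 : k) • S *ᵥ x := by
    rw [smul_mulVec, smul_inv_smul₀ two_ne_zero]
    exact funext fun i => (gradAt_dotProduct_of_isHomogeneous_one hQ.pderiv 0 x).symm
  refine ⟨S, ?_, fun x => ?_, gradient⟩
  · ext i j
    simp [S, gradAt, pderiv_comm i j]
  · have h := gradAt_dotProduct_self hQ x
    rw [gradient, smul_dotProduct, smul_eq_mul, Nat.cast_two, dotProduct_comm] at h
    exact (mul_left_cancel₀ two_ne_zero h).symm

section
variable {k : Type*} [Field k] {n : ℕ} {ι κ : Type*} [Fintype ι] [Fintype κ]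

theorem linearIndependent_gradAt_iff {F : ι → MvPolynomial (Fin n) k} {x : Fin n → k} :
    LinearIndependent k (fun i => gradAt (F i) x) ↔ ∀ a, a ᵥ* jacobianAt F x = 0 → a = 0 := by
  have h (a : ι → k) : ∑ i, a i • gradAt (F i) x = a ᵥ* jacobianAt F x := by
    ext
    simp [vecMul, dotProduct, jacobianAt, gradAt]
  simp only [Fintype.linearIndependent_iff, h, funext_iff, Pi.zero_apply]

theorem vecMul_jacobianAt_sumElim (F : ι → MvPolynomial (Fin n) k) (G : κ → MvPolynomial (Fin n) k)
    (a : ι ⊕ κ → k) (x : Fin n → k) :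
    a ᵥ* jacobianAt (Sum.elim F G) x =
      (a ∘ Sum.inl) ᵥ* jacobianAt F x + (a ∘ Sum.inr) ᵥ* jacobianAt G x := by
  ext
  simp [vecMul, dotProduct, jacobianAt]

theorem vecMul_jacobianAt_dotProduct {ℓ : ι → MvPolynomial (Fin n) k}
    (hℓ : ∀ j, (ℓ j).IsHomogeneous 1) (a : ι → k) (x u : Fin n → k) :
    (a ᵥ* jacobianAt ℓ x) ⬝ᵥ u = a ⬝ᵥ fun j => eval u (ℓ j) := by
  rw [← dotProduct_mulVec]
  congr 1
  exact funext fun j => gradAt_dotProduct_of_isHomogeneous_one (hℓ j) x u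

theorem eq_zero_of_vecMul_jacobianAt_eq_zero [Infinite k] {ℓ : ι → MvPolynomial (Fin n) k}
    (hℓ : ∀ j, (ℓ j).IsHomogeneous 1) (h_ind : LinearIndependent k ℓ) {a : ι → k} {x : Fin n → k}
    (ha : a ᵥ* jacobianAt ℓ x = 0) : a = 0 := by
  refine funext (Fintype.linearIndependent_iff.1 h_ind a (MvPolynomial.funext fun u => ?_))
  simpa [ha, dotProduct, smul_eval] using (vecMul_jacobianAt_dotProduct hℓ a x u).symm

theorem isNonsingularSystem_sumElim [Infinite k] {c : ℕ} {F : ι → MvPolynomial (Fin n) k}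
    {ℓ : Fin c → MvPolynomial (Fin n) k} {L : Submodule k (Fin n → k)}
    (hℓ : IsMinimalEquations ℓ L)
    (h : ∀ x ∈ L, x ≠ 0 → (∀ i, eval x (F i) = 0) →
      ∀ a, (∀ u ∈ L, (a ᵥ* jacobianAt F x) ⬝ᵥ u = 0) → a = 0) :
    IsNonsingularSystem (Sum.elim F ℓ) := by
  intro x hx hzero
  rw [linearIndependent_gradAt_iff]
  intro a ha
  rw [vecMul_jacobianAt_sumElim] at ha
  have inl_eq_zero : a ∘ Sum.inl = 0 := by
    refine h x ((hℓ.mem_iff x).2 fun j => hzero (.inr j)) hx (fun i => hzero (.inl i)) _ ?_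
    intro u hu
    rw [eq_neg_of_add_eq_zero_left ha, neg_dotProduct, vecMul_jacobianAt_dotProduct hℓ.linear]
    simp [(hℓ.mem_iff u).1 hu, dotProduct]
  rw [inl_eq_zero, zero_vecMul, zero_add] at ha
  rw [← Sum.elim_comp_inl_inr a, inl_eq_zero,
    eq_zero_of_vecMul_jacobianAt_eq_zero hℓ.linear hℓ.independent ha, Sum.elim_zero_zero]

end

theorem det_ne_zero_of_isNonsingularSystem {k : Type*} [Field k] {n : ℕ}
    {Q : MvPolynomial (Fin n) k} (hQ : IsNonsingularSystem ![Q]) {S : Matrix (Fin n) (Fin n) k}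
    (hS : ∀ x, eval x Q = x ⬝ᵥ S *ᵥ x) (hS' : ∀ x, gradAt Q x = (2 : k) • S *ᵥ x) : S.det ≠ 0 := by
  intro hdet
  obtain ⟨x, hx, hSx⟩ := exists_mulVec_eq_zero_iff.2 hdet
  exact (hQ x hx (by simp [hS, hSx])).ne_zero 0 (by simp [hS', hSx])

theorem IsNonsingularSystem.eq_zero_of_vecMul_jacobianAt_eq_smul {k ι : Type*} [Field k] {n : ℕ}
    [Fintype ι] {F : ι → MvPolynomial (Fin n) k} {Q : MvPolynomial (Fin n) k}
    (h : IsNonsingularSystem (Sum.elim F ![Q])) {x : Fin n → k} (hx : x ≠ 0)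
    (hF : ∀ i, eval x (F i) = 0) (hQ : eval x Q = 0) {a : ι → k} {μ : k}
    (ha : a ᵥ* jacobianAt F x = μ • gradAt Q x) : a = 0 := by
  have hzero : ∀ i, eval x (Sum.elim F ![Q] i) = 0 := by
    rintro (i | i)
    · exact hF i
    · simpa using hQ
  have h' := linearIndependent_gradAt_iff.1 (h x hx hzero) (Sum.elim a fun _ => -μ) (by
    rw [vecMul_jacobianAt_sumElim, Sum.elim_comp_inl, Sum.elim_comp_inr, ha]
    ext
    simp [vecMul, dotProduct, jacobianAt, gradAt])
  exact funext fun i => congrFun h' (.inl i)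

theorem IsNonsingularSystem.comp_equiv {k ι κ : Type*} [Field k] {n : ℕ}
    {F : ι → MvPolynomial (Fin n) k} (h : IsNonsingularSystem F) (e : κ ≃ ι) :
    IsNonsingularSystem (F ∘ e) :=
  fun x hx hzero => (h x hx (e.forall_congr_right.1 hzero)).comp e e.injective

theorem IsNonsingularSystem.sumElim_of_vec {k : Type*} [Field k] {n : ℕ}
    {F₁ F₂ F₃ : MvPolynomial (Fin n) k} (h : IsNonsingularSystem ![F₁, F₂, F₃]) :
    IsNonsingularSystem (Sum.elim ![F₁, F₂] ![F₃]) := by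
  convert h.comp_equiv (finSumFinEquiv (m := 2) (n := 1)) using 1
  ext (i | i) <;> fin_cases i <;> rfl

/-- The linear functional `φ` as a homogeneous polynomial of degree one. -/
noncomputable def linearForm {k : Type*} [CommRing k] {n : ℕ} (φ : Module.Dual k (Fin n → k)) :
    MvPolynomial (Fin n) k :=
  ∑ i, C (φ (Pi.single i 1)) * X i

theorem isHomogeneous_linearForm {k : Type*} [CommRing k] {n : ℕ} (φ : Module.Dual k (Fin n → k)) :
    (linearForm φ).IsHomogeneous 1 :=
  .sum _ _ _ fun i _ => by simpa using (isHomogeneous_C _ _).mul (isHomogeneous_X k i)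

theorem eval_linearForm {k : Type*} [CommRing k] {n : ℕ} (φ : Module.Dual k (Fin n → k))
    (x : Fin n → k) : eval x (linearForm φ) = φ x := by
  conv_rhs => rw [pi_eq_sum_univ' x]
  simp [linearForm, mul_comm]

theorem exists_isMinimalEquations {k : Type*} [Field k] {n : ℕ} (L : Submodule k (Fin n → k)) :
    ∃ (c : ℕ) (ℓ : Fin c → MvPolynomial (Fin n) k), IsMinimalEquations ℓ L := by
  let β := Module.finBasis k ((Fin n → k) ⧸ L)
  let φ j : Module.Dual k (Fin n → k) := L.mkQ.dualMap (β.coord j)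
  have φ_independent : LinearIndependent k φ := β.linearIndependent_coord.map' _
    (LinearMap.ker_eq_bot.2 (LinearMap.dualMap_injective_of_surjective L.mkQ_surjective))
  refine ⟨_, fun j => linearForm (φ j), fun j => isHomogeneous_linearForm _, ?_, fun x => ?_⟩
  · rw [Fintype.linearIndependent_iff] at φ_independent ⊢
    intro g hg
    refine φ_independent g (LinearMap.ext fun u => ?_)
    simpa [smul_eval, eval_linearForm] using congrArg (eval u) hg
  · simp only [eval_linearForm]
    rw [← Submodule.Quotient.mk_eq_zero L, ← β.forall_coord_eq_zero_iff]
    rfl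

theorem lemma3_general {k : Type*} [Field k] [IsAlgClosed k] [CharZero k] {n : ℕ} {ι : Type*}
    [Finite ι] (F : ι → MvPolynomial (Fin n) k) (Q : MvPolynomial (Fin n) k)
    (hQ : Q.IsHomogeneous 2) (hFQ : IsNonsingularSystem (Sum.elim F ![Q]))
    (hQns : IsNonsingularSystem ![Q]) (t : ℕ) (ht : 2 * (t + 1) ≤ n) :
    ∃ L ∈ fano Q t, ∃ (c : ℕ) (ℓ : Fin c → MvPolynomial (Fin n) k),
      IsMinimalEquations ℓ L ∧ IsNonsingularSystem (Sum.elim F ℓ) := by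
  have := Fintype.ofFinite ι
  obtain ⟨S, S_symm, eval_Q, gradAt_Q⟩ := exists_symmetric_gradAt_eq_mulVec hQ
  have det_S := det_ne_zero_of_isNonsingularSystem hQns eval_Q gradAt_Q
  obtain ⟨E, E_injective, hE⟩ :=
    exists_injective_dotProduct_mulVec_eq_zero S (m := t + 1) (by simpa using ht)
  obtain ⟨M, M_add_transpose, det_M, transversal⟩ :=
    exists_forall_isTangency_eq_zero S_symm det_S hE (F := F) fun y hy hF hyS a μ ha =>
      hFQ.eq_zero_of_vecMul_jacobianAt_eq_smul hy hF ((eval_Q y).trans hyS) (μ := μ / 2) <| by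
        rw [ha, gradAt_Q, smul_smul, div_mul_cancel₀ _ two_ne_zero]
  have isotropic (u) (hu : u ∈ cayleyTranslate M E) : eval u Q = 0 := by
    obtain ⟨c, hc⟩ := (mem_cayleyTranslate_iff det_M).1 hu
    rw [eval_Q, dotProduct_mulVec_eq_of_mulVec_eq M_add_transpose hc, hE]
  obtain ⟨c, ℓ, hℓ⟩ := exists_isMinimalEquations (cayleyTranslate M E)
  refine ⟨_, ⟨by simp [finrank_cayleyTranslate det_M E_injective], isotropic⟩, c, ℓ, hℓ,
    isNonsingularSystem_sumElim hℓ fun y hy y_ne_zero hF a ha => ?_⟩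
  obtain ⟨b, hb⟩ := (mem_cayleyTranslate_iff det_M).1 hy
  obtain ⟨z, hz⟩ := IsTangency.exists_of_orthogonal det_M hb hF ha
  exact transversal _ _ _ _ hz y_ne_zero

theorem lemma3 {k : Type*} [Field k] [IsAlgClosed k] [CharZero k] (n : ℕ)
    (Q₁ Q₂ Q₃ : MvPolynomial (Fin n) k)
    (hQ₁ : Q₁.IsHomogeneous 2) (hQ₂ : Q₂.IsHomogeneous 2) (hQ₃ : Q₃.IsHomogeneous 2)
    (hR : IsNonsingularSystem ![Q₁, Q₂, Q₃])
    (hQ₁₂ : IsNonsingularSystem ![Q₁, Q₂])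
    (hQ₃ns : IsNonsingularSystem ![Q₃])
    (t : ℕ) (ht : 3 ≤ t) (htn : (t : ℚ) ≤ ((n : ℚ) - 5) / 2) :
    ∃ L ∈ fano Q₃ t, IsNonsingularSection L Q₁ Q₂ := by
  have : (2 * (t + 1) : ℚ) ≤ n := by linarith
  exact lemma3_general ![Q₁, Q₂] Q₃ hQ₃ hR.sumElim_of_vec hQ₃ns t (by exact_mod_cast this)
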